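/- Fix $d\in\mathbb N$, $d\ge 1$. For a nonempty set $\mathcal X\subseteq\mathbb R^d$ and $\alpha,B>0$, let $\mathcal O_{\rm sc}$ be the class of all pairs $(f,O)$ where $f:\mathcal X\to\mathbb R$ is convex, $x\mapsto f(x)-\frac{\alpha}{2}\|x\|_2^2$ is convex on $\mathcal X$ (so that $\mathcal X$ is convex whenever the class is nonempty), and $O$ is a stochastic oracle that answers each query $x\in\mathcal X$ with a random vector $\hat g(x)\in\mathbb R^d$ (drawn with fresh randomness at each query) such that $\mathbb E[\hat g(x)\mid x]\in\partial f(x)$, where $\partial f(x)=\{g: f(y)\ge f(x)+\langle g,y-x\rangle\ \forall y\in\mathcal X\}$, and $\|\hat g(x)\|_2^2\le B^2$ almost surely. Let $\mathcal W_{{\rm com},r}$ be the set of all (randomized) channels $W:\mathbb R^d\to\{0,1\}^r$. A (possibly randomized) algorithm $\pi$ with $T$ queries and an adaptive channel selection strategy $S$ interact with the oracle as follows: in round $t=1,\dots,T$ the algorithm queries a point $x_t\in\mathcal X$ that depends on $Y_1,\dots,Y_{t-1}$ and on its private randomness, the strategy selects a channel $W_t\in\mathcal W_{{\rm com},r}$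 as a function of $Y_1,\dots,Y_{t-1}$, and the output $Y_t\sim W_t(\cdot\mid\hat g(x_t))$ is observed; finally $\pi$ outputs a point $\hat x\in\mathcal X$ depending on $Y_1,\dots,Y_T$ and on its private randomness. Let $$\mathcal E^*(\mathcal X,\mathcal O_{\rm sc},T,\mathcal W_{{\rm com},r})=\inf_{\pi}\inf_{S}\sup_{(f,O)\in\mathcal O_{\rm sc}}\mathbb E\Big[f(\hat x)-\inf_{x\in\mathcal X}f(x)\Big]$$ be the adaptive minmax optimization error, and let $\mathbb X_2(D)$ be the collection of nonempty sets $\mathcal X\subseteq\mathbb R^d$ with $\|x-y\|_2\le D$ for all $x,y\in\mathcal X$. **Theorem.** There exist absolute constants $c_0,c_1>0$ such that, for all integers $d,r\ge 1$, all $D,B,\alpha>0$ with $\frac{B}{\alpha}\ge\frac{D}{8}$, and all $T\in\mathbb N$ with $T\ge c_0\cdot\frac{B^2}{\alpha^2D^2}\cdot\frac{d}{d\wedge r}$, $$\sup_{\mathcal X\in\mathbb X_2(D)}\mathcal E^*(\mathcal X,\mathcal O_{\rm sc},T,\mathcal W_{{\rm com},r})\ \ge\ \frac{c_1B^2}{\alpha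 T}\cdot\frac{d}{d\wedge r}.$$ -/

import Mathlib

open MeasureTheory ProbabilityTheory
open scoped ENNReal

noncomputable section

/-- `ℝ^d` with the Euclidean norm. -/
abbrev Euc (d : ℕ) : Type := EuclideanSpace ℝ (Fin d)

/-- The alphabet `{0,1}^r`. -/
abbrev Bits (r : ℕ) : Type := Fin r → Bool

/-- The family `𝕏₂(D)` of (nonempty) subsets of `ℝ^d` of `ℓ₂` diameter at most `D`. -/
def domainFamily (d : ℕ) (D : ℝ) : Set (Set (Euc d)) :=
  {X | X.Nonempty ∧ ∀ x ∈ X, ∀ y ∈ X, ‖x - y‖ ≤ D}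

/-- The subdifferential at `x` of a function `f` with domain `X`. -/
def subdifferential {d : ℕ} (X : Set (Euc d)) (f : Euc d → ℝ) (x : Euc d) : Set (Euc d) :=
  {g | ∀ y ∈ X, f x + inner ℝ g (y - x) ≤ f y}

/-- A stochastic first-order oracle on `X`: `O x` is the law of the answer to the query `x`
(answers to successive queries use fresh independent randomness, see `transcript`). -/
abbrev Oracle {d : ℕ} (X : Set (Euc d)) : Type := Kernel X (Euc d)

/-- The class `𝒪_sc` of pairs (function on `X`, oracle): the function is convex and `α`-strongly
convex on `X`, and the oracle's answers are unbiased subgradient estimates whose `ℓ₂` norm is at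
most `B` almost surely. Only the values of the function on `X` matter. -/
def strongConvexClass {d : ℕ} (X : Set (Euc d)) (α B : ℝ) : Set ((Euc d → ℝ) × Oracle X) :=
  {p | ConvexOn ℝ X p.1 ∧
    ConvexOn ℝ X (fun x => p.1 x - α / 2 * ‖x‖ ^ 2) ∧
    IsMarkovKernel p.2 ∧
    (∀ x : X, ∫ g, g ∂(p.2 x) ∈ subdifferential X p.1 x) ∧
    (∀ x : X, ∀ᵐ g ∂(p.2 x), ‖g‖ ^ 2 ≤ B ^ 2)}

/-- The family `𝒲_com,r` of `r`-bit communication-constrained channels: all channels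
(Markov kernels) from `ℝ^d` to `{0,1}^r`. -/
abbrev CommChannel (d r : ℕ) : Type :=
  {W : Kernel (Euc d) (Bits r) // IsMarkovKernel W}

/-- Adaptive channel selection strategies: the channel used in round `t` is a function of
the messages received in the earlier rounds. -/
abbrev ChannelStrategy (d r T : ℕ) : Type :=
  (t : Fin T) → (Fin t → Bits r) → CommChannel d r

/-- First-order optimization algorithms on `X` with `T` queries. The algorithm may be randomized,
through a private random seed. The query of round `t` depends on the seed and on the messages
received in the earlier rounds, the final output on the seed and on all `T` messages. -/
structure Algorithm {d : ℕ} (X : Set (Euc d)) (r T : ℕ) where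
  Seed : Type
  [measurableSpaceSeed : MeasurableSpace Seed]
  seedLaw : Measure Seed
  [isProbabilityMeasure_seedLaw : IsProbabilityMeasure seedLaw]
  query : (t : Fin T) → Seed → (Fin t → Bits r) → X
  measurable_query : ∀ t y, Measurable fun u => query t u y
  output : Seed → (Fin T → Bits r) → X
  measurable_output : ∀ y, Measurable fun u => output u y

attribute [instance] Algorithm.measurableSpaceSeed Algorithm.isProbabilityMeasure_seedLaw

/-- The law of the first `t` messages when the algorithm `π` has seed `u`: given the
messages `y` of the rounds before, the algorithm queries a point, the oracle's answer passes
through the selected channel, and the channel output is appended to `y`. -/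
def transcript {d r T : ℕ} {X : Set (Euc d)} (O : Oracle X) (π : Algorithm X r T)
    (S : ChannelStrategy d r T) (u : π.Seed) : (t : ℕ) → t ≤ T → Measure (Fin t → Bits r)
  | 0, _ => Measure.dirac Fin.elim0
  | t + 1, h =>
    (transcript O π S u t (Nat.le_of_succ_le h)).bind fun y =>
      (((S ⟨t, h⟩ y).1 ∘ₖ O) (π.query ⟨t, h⟩ u y)).map fun b =>
        Fin.snoc (α := fun _ => Bits r) y b

/-- The expected optimality gap `E[f(x̂) - min_X f]` of the output of the algorithm. -/
def optError {d r T : ℕ} {X : Set (Euc d)} (f : Euc d → ℝ) (O : Oracle X)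
    (π : Algorithm X r T) (S : ChannelStrategy d r T) : ℝ≥0∞ :=
  ∫⁻ u, ∫⁻ y, ENNReal.ofReal (f (π.output u y) - ⨅ x : X, f x)
    ∂(transcript O π S u T le_rfl) ∂π.seedLaw

/-- The adaptive minmax optimization error `ℰ*(X, 𝒪_sc, T, 𝒲_com,r)`. -/
def minmaxError {d : ℕ} (X : Set (Euc d)) (α B : ℝ) (r T : ℕ) : ℝ≥0∞ :=
  ⨅ (π : Algorithm X r T) (S : ChannelStrategy d r T),
    ⨆ p ∈ strongConvexClass X α B, optError p.1 p.2 π S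

end

/-! The hard instances live on a ball about 0: for each sign vector `v`, take `α/2 * ‖x - γ v‖ ^ 2`
with an oracle answering `α x - s z`, where the random signs `z` have means `ρ v` and `γ = s ρ / α`.
Each coordinate of the output with the wrong sign costs at least `α γ ^ 2 / 2`, so optimizing forces
estimation of `v` (`errors_le_quadratic`). The query only shifts the answer by a known vector, which
the channel can absorb, so adaptive querying yields no more than a fresh sample of `z` sent through
`r` bits.

Negating one coordinate of `v` multiplies the law of `z` by `1 - φ i`, with `φ i` centred,
independent across `i` and at most `4 ρ` in size. The divergences of one message, summed over `i`,
are controlled by the squared conditional means of the `φ i` given the message. Boundedness gives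
order `ρ ^ 2 * d`; sub-Gaussianity and the entropy of `r` bits give order `ρ ^ 2 * r`
(`sum_log_div_channel_le`). By the chain rule `T` rounds yield at most `T` times this, and Assouad's
lemma (`card_mul_le_sum_errors`) keeps order `d` signs wrong on average while `T ρ ^ 2 min d r` is a
small multiple of `d`. The largest such `ρ` gives the rate. -/

section Auxiliary

open Finset

/-! ### Logarithmic inequalities and divergence on finite types -/

/-- Summed over two laws this says that their overlap is at least `1/2` minus the divergence. With
`t = q / p` it follows from `log t ≤ t - 1` and `log (2 t) ≤ 2 t - 1`, the latter because `log 2 >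
1/2`. Being linear in the divergence, it can be added over coordinates. -/
theorem half_sub_log_le_min {p q : ℝ} (hp : 0 ≤ p) (hq : 0 ≤ q) (h : q = 0 → p = 0) :
    p / 2 - p * Real.log (p / q) - (q - p) ≤ min p q := by
  rcases hp.eq_or_lt with rfl | hp
  · simp [hq]
  have hq : 0 < q := hq.lt_of_ne fun h' => hp.ne' (h h'.symm)
  have hlog : Real.log (p / q) = -Real.log (q / p) := by
    rw [← Real.log_inv, inv_div]
  have ht : 0 < q / p := by positivity
  have h1 := mul_le_mul_of_nonneg_left (Real.log_le_sub_one_of_pos ht) hp.le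
  have h2 := Real.log_le_sub_one_of_pos (mul_pos two_pos ht)
  rw [Real.log_mul two_ne_zero ht.ne'] at h2
  have h2 := mul_le_mul_of_nonneg_left h2 hp.le
  have h3 : p * (q / p) = q := by field_simp
  have h4 := mul_le_mul_of_nonneg_left Real.log_two_gt_d9.le hp.le
  rw [hlog]
  refine le_min ?_ ?_ <;> nlinarith

/-- Divergence is dominated by chi-squared; the linear term `p - q` cancels once summed over two
laws. The bound `q ≤ 3 * p` matters only at `p = 0`, where it forces `q = 0`. -/
theorem mul_log_div_le {p q : ℝ} (hp : 0 ≤ p) (hq : p / 3 ≤ q) (hq' : q ≤ 3 * p) :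
    p * Real.log (p / q) ≤ (p - q) + 3 * ((p - q) ^ 2 / p) := by
  rcases hp.eq_or_lt with rfl | hp
  · obtain rfl : q = 0 := by linarith
    simp
  have hq0 : 0 < q := by linarith
  have h1 := mul_le_mul_of_nonneg_left (Real.log_le_sub_one_of_pos (div_pos hp hq0)) hp.le
  have h2 : p * (p / q - 1) = (p - q) + (p - q) ^ 2 / q := by field_simp; ring
  have h3 : (p - q) ^ 2 / q ≤ (p - q) ^ 2 / (p / 3) :=
    div_le_div_of_nonneg_left (sq_nonneg _) (by positivity) hq
  have h4 : (p - q) ^ 2 / (p / 3) = 3 * ((p - q) ^ 2 / p) := by field_simp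
  linarith

/-- The chain rule for the Kullback-Leibler divergence on finite types. -/
theorem sum_mul_log_div_chain {Y β : Type*} [Fintype Y] [Fintype β] (P Q : Y → ℝ)
    (k l : Y → β → ℝ) (hk : ∀ y, ∑ b, k y b = 1) (hPQ : ∀ y, Q y = 0 → P y = 0)
    (hkl : ∀ y b, l y b = 0 → k y b = 0) :
    ∑ y, ∑ b, P y * k y b * Real.log (P y * k y b / (Q y * l y b)) =
      ∑ y, P y * Real.log (P y / Q y) +
        ∑ y, P y * ∑ b, k y b * Real.log (k y b / l y b) := by
  rw [← sum_add_distrib]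
  refine sum_congr rfl fun y _ => ?_
  have : P y * Real.log (P y / Q y) = ∑ b, k y b * (P y * Real.log (P y / Q y)) := by
    rw [← sum_mul, hk, one_mul]
  rw [this, mul_sum, ← sum_add_distrib]
  refine sum_congr rfl fun b _ => ?_
  by_cases hP : P y = 0
  · simp [hP]
  by_cases hb : k y b = 0
  · simp [hb]
  have hQ := mt (hPQ y) hP
  have hl := mt (hkl y b) hb
  rw [mul_div_mul_comm, Real.log_mul (div_ne_zero hP hQ) (div_ne_zero hb hl)]
  ring

/-- One round of the chain rule for all alternatives at once: the conditional divergences are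
controlled only after summing over `i`, so that sum has to be taken inside the average over `y`. -/
theorem sum_sum_mul_log_div_chain_le {Y β ι : Type*} [Fintype Y] [Fintype β] [Fintype ι]
    {P : Y → ℝ} {Q : ι → Y → ℝ} {k : Y → β → ℝ} {l : ι → Y → β → ℝ} {κ κ' : ℝ}
    (hP0 : ∀ y, 0 ≤ P y) (hP : ∑ y, P y = 1) (hk : ∀ y, ∑ b, k y b = 1)
    (hPQ : ∀ i y, Q i y = 0 → P y = 0) (hkl : ∀ i y b, l i y b = 0 → k y b = 0)
    (hκ' : ∑ i, ∑ y, P y * Real.log (P y / Q i y) ≤ κ')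
    (hκ : ∀ y, ∑ i, ∑ b, k y b * Real.log (k y b / l i y b) ≤ κ) :
    ∑ i, ∑ y, ∑ b, P y * k y b * Real.log (P y * k y b / (Q i y * l i y b)) ≤ κ' + κ := by
  have hstep : ∑ y, ∑ i, P y * ∑ b, k y b * Real.log (k y b / l i y b) ≤ κ := by
    calc _ ≤ ∑ y, P y * κ := sum_le_sum fun y _ => by
          rw [← mul_sum]
          exact mul_le_mul_of_nonneg_left (hκ y) (hP0 y)
      _ = κ := by rw [← sum_mul, hP, one_mul]
  rw [sum_comm] at hstep
  calc _ = ∑ i, (∑ y, P y * Real.log (P y / Q i y) +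
        ∑ y, P y * ∑ b, k y b * Real.log (k y b / l i y b)) :=
        sum_congr rfl fun i _ => sum_mul_log_div_chain _ _ _ _ hk (hPQ i) (hkl i)
    _ ≤ _ := by
      rw [sum_add_distrib]
      exact add_le_add hκ' hstep

theorem sum_mul_log_inv_le_log_card {β : Type*} [Fintype β] [Nonempty β] (p : β → ℝ)
    (hp : ∀ b, 0 ≤ p b) (hs : ∑ b, p b = 1) :
    ∑ b, p b * Real.log (1 / p b) ≤ Real.log (Fintype.card β) := by
  have hN : (0 : ℝ) < Fintype.card β := by exact_mod_cast Fintype.card_pos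
  have key : ∀ b, p b * Real.log (1 / p b) ≤
      p b * Real.log (Fintype.card β) + (1 / Fintype.card β - p b) := by
    intro b
    rcases (hp b).eq_or_lt with h | h
    · rw [← h]; simp
    have h1 : 0 < 1 / (p b * Fintype.card β) := by positivity
    have h2 := mul_le_mul_of_nonneg_left (Real.log_le_sub_one_of_pos h1) h.le
    have h3 : Real.log (1 / (p b * Fintype.card β)) =
        Real.log (1 / p b) - Real.log (Fintype.card β) := by
      rw [← Real.log_div (by positivity) hN.ne', div_div]
    have h4 : p b * (1 / (p b * Fintype.card β) - 1) = 1 / Fintype.card β - p b := by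
      field_simp
    rw [h3, h4] at h2
    linarith
  calc _ ≤ _ := sum_le_sum fun b _ => key b
    _ = _ := by
      rw [sum_add_distrib, ← sum_mul, hs, sum_sub_distrib, hs]
      simp [hN.ne']

/-! ### Information passing through a finite channel -/

section Information

variable {Ω β ι : Type*} [Fintype Ω] [Fintype β] [Fintype ι] {w : Ω → ℝ} {W : β → Ω → ℝ}
  {φ : ι → Ω → ℝ} {c : ℝ}

theorem sum_channel_eq_one (hs : ∑ z, w z = 1) (hW1 : ∀ z, ∑ b, W b z = 1) :
    ∑ b, ∑ z, w z * W b z = 1 := by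
  rw [sum_comm]
  simp [← mul_sum, hW1, hs]

/-- A conditional mean of `φ i` is at most `c` in absolute value, so each term is at most `c ^ 2`
times the probability of `b`. -/
theorem sum_channel_sq_div_le_card (hw : ∀ z, 0 ≤ w z) (hs : ∑ z, w z = 1)
    (hW : ∀ b z, 0 ≤ W b z) (hW1 : ∀ z, ∑ b, W b z = 1) (hφ : ∀ i z, |φ i z| ≤ c) :
    ∑ i, ∑ b, (∑ z, w z * W b z * φ i z) ^ 2 / (∑ z, w z * W b z) ≤
      c ^ 2 * Fintype.card ι := by
  have key : ∀ i b, (∑ z, w z * W b z * φ i z) ^ 2 / (∑ z, w z * W b z) ≤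
      c ^ 2 * ∑ z, w z * W b z := by
    intro i b
    have hp : 0 ≤ ∑ z, w z * W b z := sum_nonneg fun z _ => mul_nonneg (hw z) (hW b z)
    refine div_le_of_le_mul₀ hp (by positivity) ?_
    have h1 : |∑ z, w z * W b z * φ i z| ≤ c * ∑ z, w z * W b z := by
      rw [mul_sum]
      refine (abs_sum_le_sum_abs _ _).trans (sum_le_sum fun z _ => ?_)
      rw [abs_mul, abs_of_nonneg (mul_nonneg (hw z) (hW b z)), mul_comm]
      exact mul_le_mul_of_nonneg_right (hφ i z) (mul_nonneg (hw z) (hW b z))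
    calc _ = |∑ z, w z * W b z * φ i z| ^ 2 := (sq_abs _).symm
      _ ≤ (c * ∑ z, w z * W b z) ^ 2 := pow_le_pow_left₀ (abs_nonneg _) h1 2
      _ = _ := by ring
  calc _ ≤ ∑ i : ι, ∑ b, c ^ 2 * ∑ z, w z * W b z :=
        sum_le_sum fun i _ => sum_le_sum fun b _ => key i b
    _ = _ := by
      rw [← mul_sum, sum_channel_eq_one hs hW1]
      simp [mul_comm]

/-- The information about sub-Gaussian statistics that passes through a channel is bounded by
the entropy of its output. -/
theorem sum_channel_sq_div_le_log_card [Nonempty β] (hw : ∀ z, 0 ≤ w z) (hs : ∑ z, w z = 1)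
    (hW : ∀ b z, 0 ≤ W b z) (hW1 : ∀ z, ∑ b, W b z = 1) (hc : 0 < c)
    (hφ : ∀ a : ι → ℝ, ∑ z, w z * Real.exp (∑ i, a i * φ i z) ≤
      Real.exp (c ^ 2 * (∑ i, a i ^ 2) / 2)) :
    ∑ i, ∑ b, (∑ z, w z * W b z * φ i z) ^ 2 / (∑ z, w z * W b z) ≤
      2 * c ^ 2 * Real.log (Fintype.card β) := by
  have hp : ∀ b, 0 ≤ ∑ z, w z * W b z :=
    fun b => sum_nonneg fun z _ => mul_nonneg (hw z) (hW b z)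
  have key : ∀ b, ∑ i, (∑ z, w z * W b z * φ i z) ^ 2 / (∑ z, w z * W b z) ≤
      2 * c ^ 2 * ((∑ z, w z * W b z) * Real.log (1 / ∑ z, w z * W b z)) := by
    intro b
    have hpb := hp b
    set p := ∑ z, w z * W b z with hpdef
    rcases hpb.eq_or_lt with h | h
    · rw [← h]; simp
    -- `m i` is the conditional mean of `φ i` given the output `b`.
    set m : ι → ℝ := fun i => (∑ z, w z * W b z * φ i z) / p with hm
    set S := ∑ i, m i ^ 2 with hS
    have hsum : ∑ i, (∑ z, w z * W b z * φ i z) ^ 2 / p = p * S := by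
      rw [hS, mul_sum]
      refine sum_congr rfl fun i _ => ?_
      simp only [hm]; field_simp
    -- Jensen under the conditional law with tilt `a = m / c ^ 2`. Dropping `W b z ≤ 1` costs a
    -- factor `1 / p`, so `S / c ^ 2 ≤ log (1 / p) + S / (2 * c ^ 2)`.
    have hjen := convexOn_exp.map_sum_le (t := univ) (w := fun z => w z * W b z / p)
      (p := fun z => ∑ i, m i / c ^ 2 * φ i z)
      (fun z _ => div_nonneg (mul_nonneg (hw z) (hW b z)) h.le)
      (by rw [← sum_div, ← hpdef, div_self h.ne']) (fun _ _ => Set.mem_univ _)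
    simp only [smul_eq_mul] at hjen
    have hE : ∑ z, w z * W b z / p * ∑ i, m i / c ^ 2 * φ i z = S / c ^ 2 := by
      simp only [mul_sum]
      rw [sum_comm, hS, sum_div]
      refine sum_congr rfl fun i _ => ?_
      have : m i ^ 2 / c ^ 2 = m i / c ^ 2 * ((∑ z, w z * W b z * φ i z) / p) := by
        rw [← show m i = _ from rfl]; ring
      rw [this, sum_div, mul_sum]
      exact sum_congr rfl fun z _ => by ring
    rw [hE] at hjen
    have hW1' : ∀ z, W b z ≤ 1 := fun z => by
      rw [← hW1 z]; exact single_le_sum (f := fun b => W b z) (fun b _ => hW b z) (mem_univ b)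
    have hle : ∑ z, w z * W b z / p * Real.exp (∑ i, m i / c ^ 2 * φ i z) ≤
        1 / p * Real.exp (S / c ^ 2 / 2) := by
      calc _ ≤ 1 / p * ∑ z, w z * Real.exp (∑ i, m i / c ^ 2 * φ i z) := by
            rw [mul_sum]
            refine sum_le_sum fun z _ => ?_
            have h1 : 0 ≤ w z * Real.exp (∑ i, m i / c ^ 2 * φ i z) / p := by
              have := hw z; positivity
            calc _ = w z * Real.exp (∑ i, m i / c ^ 2 * φ i z) / p * W b z := by ring
              _ ≤ w z * Real.exp (∑ i, m i / c ^ 2 * φ i z) / p * 1 :=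
                mul_le_mul_of_nonneg_left (hW1' z) h1
              _ = _ := by ring
        _ ≤ _ := by
            refine mul_le_mul_of_nonneg_left ((hφ _).trans_eq ?_) (by positivity)
            congr 1
            simp only [div_pow, ← sum_div, ← hS]
            field_simp
    have h2 := Real.log_le_log (Real.exp_pos _) (hjen.trans hle)
    rw [Real.log_exp, Real.log_mul (by positivity) (Real.exp_pos _).ne', Real.log_exp] at h2
    have h3 : S ≤ 2 * c ^ 2 * Real.log (1 / p) := by
      have h4 : S / c ^ 2 / 2 ≤ Real.log (1 / p) := by linarith
      rw [div_div, div_le_iff₀ (by positivity)] at h4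
      linarith
    rw [hsum]
    calc _ ≤ p * (2 * c ^ 2 * Real.log (1 / p)) := mul_le_mul_of_nonneg_left h3 h.le
      _ = _ := by ring
  rw [sum_comm]
  calc _ ≤ _ := sum_le_sum fun b _ => key b
    _ ≤ _ := by
      rw [← mul_sum]
      exact mul_le_mul_of_nonneg_left
        (sum_mul_log_inv_le_log_card _ hp (sum_channel_eq_one hs hW1)) (by positivity)

end Information

/-! ### Biased sign vectors and one-round information -/

noncomputable section Construction

/-- The sign `±1` encoded by a Boolean. -/
def boolSign (b : Bool) : ℝ := if b then 1 else -1

@[simp] theorem boolSign_true : boolSign true = 1 := rfl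

@[simp] theorem boolSign_false : boolSign false = -1 := rfl

@[simp] theorem boolSign_sq (b : Bool) : boolSign b ^ 2 = 1 := by cases b <;> simp

/-- The Boolean vector `v` with coordinate `i` negated. -/
def flipAt {d : ℕ} (i : Fin d) (v : Fin d → Bool) : Fin d → Bool := Function.update v i (!v i)

theorem flipAt_flipAt {d : ℕ} (i : Fin d) (v : Fin d → Bool) : flipAt i (flipAt i v) = v := by
  simp [flipAt]

/-- The mass function of independent signs with means `ρ * boolSign (v i)`. -/
def biasWeight {d : ℕ} (ρ : ℝ) (v z : Fin d → Bool) : ℝ :=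
  ∏ i, (1 + ρ * (boolSign (v i) * boolSign (z i))) / 2

/-- The relative change of `biasWeight ρ v` when coordinate `i` of `v` is negated. -/
def biasScore {d : ℕ} (ρ : ℝ) (v : Fin d → Bool) (i : Fin d) (z : Fin d → Bool) : ℝ :=
  2 * ρ * (boolSign (v i) * boolSign (z i)) / (1 + ρ * (boolSign (v i) * boolSign (z i)))

section

variable {d : ℕ} {ρ : ℝ}

theorem bias_factor_pos (hρ : 0 < ρ) (hρ' : ρ ≤ 1 / 2) (a b : Bool) :
    0 < 1 + ρ * (boolSign a * boolSign b) := by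
  cases a <;> cases b <;> simp <;> linarith

theorem biasWeight_nonneg (hρ : 0 < ρ) (hρ' : ρ ≤ 1 / 2) (v z : Fin d → Bool) :
    0 ≤ biasWeight ρ v z :=
  prod_nonneg fun _ _ => div_nonneg (bias_factor_pos hρ hρ' _ _).le zero_le_two

theorem sum_biasWeight_mul_prod (v : Fin d → Bool) (g : Fin d → Bool → ℝ) :
    ∑ z, biasWeight ρ v z * ∏ i, g i (z i) =
      ∏ i, ∑ b, (1 + ρ * (boolSign (v i) * boolSign b)) / 2 * g i b := by
  rw [prod_univ_sum, Fintype.piFinset_univ]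
  simp [biasWeight, prod_mul_distrib]

theorem sum_biasWeight (v : Fin d → Bool) : ∑ z, biasWeight ρ v z = 1 := by
  have := sum_biasWeight_mul_prod (ρ := ρ) v fun _ _ => 1
  simp only [prod_const_one, mul_one] at this
  rw [this]
  refine prod_eq_one fun i _ => ?_
  simp
  ring

theorem sum_biasWeight_mul_sign (v : Fin d → Bool) (i : Fin d) :
    ∑ z, biasWeight ρ v z * boolSign (z i) = ρ * boolSign (v i) := by
  have := sum_biasWeight_mul_prod (ρ := ρ) v fun j b => if j = i then boolSign b else 1
  simp only [prod_ite_eq', mem_univ, if_true] at this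
  rw [this, prod_eq_single i]
  · simp; ring
  · intro j _ hj
    simp [hj]; ring
  · simp

theorem biasWeight_flipAt (hρ : 0 < ρ) (hρ' : ρ ≤ 1 / 2) (v z : Fin d → Bool) (i : Fin d) :
    biasWeight ρ (flipAt i v) z = biasWeight ρ v z * (1 - biasScore ρ v i z) := by
  have hpos := bias_factor_pos hρ hρ' (v i) (z i)
  rw [biasWeight, biasWeight, ← mul_prod_erase univ _ (mem_univ i),
    ← mul_prod_erase univ _ (mem_univ i), mul_right_comm]
  congr 1
  · have : boolSign (!v i) = -boolSign (v i) := by cases v i <;> simp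
    simp only [flipAt, Function.update_self, this, biasScore, neg_mul]
    generalize boolSign (v i) * boolSign (z i) = s at hpos
    field_simp
    ring
  · refine prod_congr rfl fun j hj => ?_
    rw [flipAt, Function.update_of_ne (ne_of_mem_erase hj)]

/-- The first two bounds place the likelihood ratio `1 - biasScore` in `[1/3, 3]`, the range needed
by `mul_log_div_le`; the third is the sub-Gaussian scale. -/
theorem biasScore_bounds (hρ : 0 < ρ) (hρ' : ρ ≤ 1 / 2) (v z : Fin d → Bool) (i : Fin d) :
    -2 ≤ biasScore ρ v i z ∧ biasScore ρ v i z ≤ 2 / 3 ∧ |biasScore ρ v i z| ≤ 4 * ρ := by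
  unfold biasScore
  have hpos := bias_factor_pos hρ hρ' (v i) (z i)
  have h1 : boolSign (v i) * boolSign (z i) = 1 ∨ boolSign (v i) * boolSign (z i) = -1 := by
    cases v i <;> cases z i <;> simp
  refine ⟨?_, ?_, abs_le.2 ⟨?_, ?_⟩⟩
  · rw [le_div_iff₀ hpos]; rcases h1 with h | h <;> rw [h] <;> linarith
  · rw [div_le_iff₀ hpos]; rcases h1 with h | h <;> rw [h] <;> linarith
  · rw [le_div_iff₀ hpos]; rcases h1 with h | h <;> rw [h] <;> nlinarith
  · rw [div_le_iff₀ hpos]; rcases h1 with h | h <;> rw [h] <;> nlinarith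

/-- The right side is the chord of the exponential over `[-c, c]`; its linear term averages to zero
for centred `x`. -/
theorem exp_mul_le_cosh_add {a c x : ℝ} (hc : 0 < c) (hx : |x| ≤ c) :
    Real.exp (a * x) ≤ Real.cosh (a * c) + x * (Real.sinh (a * c) / c) := by
  obtain ⟨h1, h2⟩ := abs_le.1 hx
  have h4 : -1 ≤ x / c := by rw [le_div_iff₀ hc]; linarith
  have h5 : x / c ≤ 1 := by rw [div_le_iff₀ hc]; linarith
  have := convexOn_exp.2 (Set.mem_univ (a * c)) (Set.mem_univ (-(a * c)))
    (show 0 ≤ (1 + x / c) / 2 by linarith) (show 0 ≤ (1 - x / c) / 2 by linarith) (by ring)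
  simp only [smul_eq_mul] at this
  have h3 : (1 + x / c) / 2 * (a * c) + (1 - x / c) / 2 * -(a * c) = a * x := by
    field_simp; ring
  rw [h3] at this
  refine this.trans_eq ?_
  rw [Real.cosh_eq, Real.sinh_eq]
  ring

theorem sum_biasWeight_mul_exp_le (hρ : 0 < ρ) (hρ' : ρ ≤ 1 / 2) (v : Fin d → Bool)
    (a : Fin d → ℝ) :
    ∑ z, biasWeight ρ v z * Real.exp (∑ i, a i * biasScore ρ v i z) ≤
      Real.exp ((4 * ρ) ^ 2 * (∑ i, a i ^ 2) / 2) := by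
  have hc : 0 < 4 * ρ := by linarith
  simp only [Real.exp_sum]
  have := sum_biasWeight_mul_prod (ρ := ρ) v fun i b => Real.exp (a i *
    (2 * ρ * (boolSign (v i) * boolSign b) / (1 + ρ * (boolSign (v i) * boolSign b))))
  simp only [biasScore, this]
  rw [mul_sum, sum_div, Real.exp_sum]
  refine prod_le_prod (fun i _ => sum_nonneg fun b _ => ?_) fun i _ => ?_
  · have := bias_factor_pos hρ hρ' (v i) b
    positivity
  have hle : ∀ b, (1 + ρ * (boolSign (v i) * boolSign b)) / 2 * Real.exp (a i *
      (2 * ρ * (boolSign (v i) * boolSign b) / (1 + ρ * (boolSign (v i) * boolSign b)))) ≤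
      (1 + ρ * (boolSign (v i) * boolSign b)) / 2 * Real.cosh (a i * (4 * ρ)) +
        ρ * (boolSign (v i) * boolSign b) * (Real.sinh (a i * (4 * ρ)) / (4 * ρ)) := by
    intro b
    have hpos := bias_factor_pos hρ hρ' (v i) b
    -- `Function.update v i b` merely supplies a sign vector whose coordinate `i` is `b`.
    have hexp := exp_mul_le_cosh_add (a := a i) hc
      (biasScore_bounds hρ hρ' v (Function.update v i b) i).2.2
    simp only [biasScore, Function.update_self] at hexp
    refine (mul_le_mul_of_nonneg_left hexp (half_pos hpos).le).trans_eq ?_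
    generalize boolSign (v i) * boolSign b = s at hpos
    field_simp
  calc _ ≤ _ := sum_le_sum fun b _ => hle b
    -- The weights sum to one and the `sinh` terms of the two signs cancel.
    _ = Real.cosh (a i * (4 * ρ)) := by simp; ring
    _ ≤ _ := Real.cosh_le_exp_half_sq _
    _ = _ := by congr 1; ring

theorem log_card_bits_le (r : ℕ) : Real.log (Fintype.card (Bits r)) ≤ r := by
  have := mul_le_mul_of_nonneg_left (Real.log_two_lt_d9.le.trans (by norm_num : _ ≤ (1 : ℝ)))
    (Nat.cast_nonneg (α := ℝ) r)
  simpa using this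

/-- One use of an `r`-bit channel reveals at most order `ρ ^ 2 * min d r` about the biases. -/
theorem sum_log_div_channel_le {r : ℕ} (hρ : 0 < ρ) (hρ' : ρ ≤ 1 / 2) (v : Fin d → Bool)
    (W : Bits r → (Fin d → Bool) → ℝ) (hW : ∀ b z, 0 ≤ W b z) (hW1 : ∀ z, ∑ b, W b z = 1) :
    ∑ i, ∑ b, (∑ z, biasWeight ρ v z * W b z) * Real.log ((∑ z, biasWeight ρ v z * W b z) /
      ∑ z, biasWeight ρ (flipAt i v) z * W b z) ≤ 96 * ρ ^ 2 * (min d r : ℕ) := by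
  have hw := biasWeight_nonneg (d := d) hρ hρ'
  have hflip : ∀ i b, ∑ z, biasWeight ρ (flipAt i v) z * W b z =
      ∑ z, biasWeight ρ v z * W b z - ∑ z, biasWeight ρ v z * W b z * biasScore ρ v i z := by
    intro i b
    rw [← sum_sub_distrib]
    exact sum_congr rfl fun z _ => by rw [biasWeight_flipAt hρ hρ']; ring
  have hterm : ∀ i b, (∑ z, biasWeight ρ v z * W b z) *
      Real.log ((∑ z, biasWeight ρ v z * W b z) / ∑ z, biasWeight ρ (flipAt i v) z * W b z) ≤
      (∑ z, biasWeight ρ v z * W b z - ∑ z, biasWeight ρ (flipAt i v) z * W b z) +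
      3 * ((∑ z, biasWeight ρ v z * W b z * biasScore ρ v i z) ^ 2 /
        ∑ z, biasWeight ρ v z * W b z) := by
    intro i b
    refine (mul_log_div_le (sum_nonneg fun z _ => mul_nonneg (hw v z) (hW b z)) ?_ ?_).trans_eq ?_
    · rw [sum_div]
      refine sum_le_sum fun z _ => ?_
      rw [biasWeight_flipAt hρ hρ']
      nlinarith [mul_nonneg (hw v z) (hW b z), (biasScore_bounds hρ hρ' v z i).2.1]
    · rw [mul_sum]
      refine sum_le_sum fun z _ => ?_
      rw [biasWeight_flipAt hρ hρ']
      nlinarith [mul_nonneg (hw v z) (hW b z), (biasScore_bounds hρ hρ' v z i).1]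
    · congr 4
      rw [hflip]; ring
  have hsum : ∑ i, ∑ b, (∑ z, biasWeight ρ v z * W b z * biasScore ρ v i z) ^ 2 /
      (∑ z, biasWeight ρ v z * W b z) ≤ 2 * (4 * ρ) ^ 2 * (min d r : ℕ) := by
    rcases min_choice d r with h | h <;> rw [h]
    · have := sum_channel_sq_div_le_card (hw v) (sum_biasWeight v) hW hW1
        (fun i z => (biasScore_bounds hρ hρ' v z i).2.2)
      rw [Fintype.card_fin] at this
      nlinarith [mul_nonneg (sq_nonneg (4 * ρ)) (Nat.cast_nonneg (α := ℝ) d)]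
    · exact (sum_channel_sq_div_le_log_card (hw v) (sum_biasWeight v) hW hW1 (by linarith)
        (sum_biasWeight_mul_exp_le hρ hρ' v)).trans
        (mul_le_mul_of_nonneg_left (log_card_bits_le r) (by positivity))
  calc _ ≤ _ := sum_le_sum fun i _ => sum_le_sum fun b _ => hterm i b
    _ = 3 * ∑ i, ∑ b, (∑ z, biasWeight ρ v z * W b z * biasScore ρ v i z) ^ 2 /
      (∑ z, biasWeight ρ v z * W b z) := by
        simp only [sum_add_distrib, sum_sub_distrib, ← mul_sum,
          sum_channel_eq_one (sum_biasWeight _) hW1]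
        simp
    _ ≤ _ := by linarith

end

/-! ### Laws of transcripts and Assouad's lemma -/

theorem sum_snoc {r t : ℕ} {M : Type*} [AddCommMonoid M] (F : (Fin (t + 1) → Bits r) → M) :
    ∑ y, F y = ∑ y : Fin t → Bits r, ∑ b, F (Fin.snoc (α := fun _ => Bits r) y b) := by
  rw [← (Fin.snocEquiv fun _ => Bits r).sum_comp, Fintype.sum_prod_type, sum_comm]
  rfl

section Transcript

variable {d r T : ℕ} {X : Set (Euc d)}

/-- The law of the message of round `t`, given the seed and the earlier messages. -/
def messageLaw (O : Oracle X) (π : Algorithm X r T) (S : ChannelStrategy d r T) (u : π.Seed)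
    (t : Fin T) (y : Fin t → Bits r) : Measure (Bits r) :=
  ((S t y).1 ∘ₖ O) (π.query t u y)

instance (O : Oracle X) [IsMarkovKernel O] (π : Algorithm X r T) (S : ChannelStrategy d r T)
    (u : π.Seed) (t : Fin T) (y : Fin t → Bits r) :
    IsProbabilityMeasure (messageLaw O π S u t y) := by
  have := (S t y).2
  unfold messageLaw
  infer_instance

theorem isProbabilityMeasure_transcript (O : Oracle X) [IsMarkovKernel O] (π : Algorithm X r T)
    (S : ChannelStrategy d r T) (u : π.Seed) :
    ∀ t h, IsProbabilityMeasure (transcript O π S u t h)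
  | 0, _ => by rw [transcript]; infer_instance
  | t + 1, h => by
    have := isProbabilityMeasure_transcript O π S u t (Nat.le_of_succ_le h)
    rw [transcript]
    refine isProbabilityMeasure_bind (measurable_of_finite _).aemeasurable (.of_forall fun y => ?_)
    exact Measure.isProbabilityMeasure_map (μ := messageLaw O π S u ⟨t, h⟩ y)
      (measurable_of_finite _).aemeasurable

theorem transcript_succ_singleton (O : Oracle X) (π : Algorithm X r T)
    (S : ChannelStrategy d r T) (u : π.Seed) (t : ℕ) (h : t + 1 ≤ T) (y : Fin t → Bits r)
    (b : Bits r) :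
    transcript O π S u (t + 1) h {Fin.snoc (α := fun _ => Bits r) y b} =
      transcript O π S u t (Nat.le_of_succ_le h) {y} * messageLaw O π S u ⟨t, h⟩ y {b} := by
  rw [transcript, Measure.bind_apply (measurableSet_singleton _)
    (measurable_of_finite _).aemeasurable, lintegral_fintype, sum_eq_single y]
  · rw [Measure.map_apply (measurable_of_finite _) (measurableSet_singleton _), mul_comm]
    congr 2
    ext b'
    simp [Fin.snoc_inj]
  · intro y' _ hy
    rw [Measure.map_apply (measurable_of_finite _) (measurableSet_singleton _)]
    have : (fun b => Fin.snoc (α := fun _ => Bits r) y' b) ⁻¹'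
        {Fin.snoc (α := fun _ => Bits r) y b} = ∅ := by
      ext b'
      simp [Fin.snoc_inj, hy]
    rw [this]
    simp
  · simp

theorem transcript_succ_real (O : Oracle X) (π : Algorithm X r T)
    (S : ChannelStrategy d r T) (u : π.Seed) (t : ℕ) (h : t + 1 ≤ T) (y : Fin t → Bits r)
    (b : Bits r) :
    (transcript O π S u (t + 1) h).real {Fin.snoc (α := fun _ => Bits r) y b} =
      (transcript O π S u t (Nat.le_of_succ_le h)).real {y} *
        (messageLaw O π S u ⟨t, h⟩ y).real {b} := by
  simp only [measureReal_def, transcript_succ_singleton, ENNReal.toReal_mul]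

theorem sum_real_singleton_eq_one {Y : Type*} [Fintype Y] [MeasurableSpace Y]
    [MeasurableSingletonClass Y] (μ : Measure Y) [IsProbabilityMeasure μ] :
    ∑ y, μ.real {y} = 1 := by
  simp

/-- Absolute continuity is essential: `Real.log (p / 0) = 0` would otherwise hide an infinite
divergence. -/
theorem transcript_real_eq_zero {O O' : Oracle X} (π : Algorithm X r T)
    (S : ChannelStrategy d r T) (u : π.Seed)
    (hac : ∀ t y b, (messageLaw O' π S u t y).real {b} = 0 →
      (messageLaw O π S u t y).real {b} = 0) :
    ∀ t h y, (transcript O' π S u t h).real {y} = 0 → (transcript O π S u t h).real {y} = 0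
  | 0, _, y => by rw [transcript, transcript]; exact id
  | t + 1, h, y => by
    rw [← Fin.snoc_init_self y]
    simp only [transcript_succ_real, mul_eq_zero]
    exact Or.imp (transcript_real_eq_zero π S u hac t _ _) (hac _ _ _)

/-- The divergence of the transcripts is at most the number of rounds times the divergence of
the messages in one round. -/
theorem sum_log_div_transcript_le {ι : Type*} [Fintype ι] {O : Oracle X} {O' : ι → Oracle X}
    [IsMarkovKernel O] (π : Algorithm X r T) (S : ChannelStrategy d r T) (u : π.Seed) {κ : ℝ}
    (hac : ∀ i t y b, (messageLaw (O' i) π S u t y).real {b} = 0 →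
      (messageLaw O π S u t y).real {b} = 0)
    (hκ : ∀ t y, ∑ i, ∑ b, (messageLaw O π S u t y).real {b} *
      Real.log ((messageLaw O π S u t y).real {b} /
        (messageLaw (O' i) π S u t y).real {b}) ≤ κ) :
    ∀ t h, ∑ i, ∑ y, (transcript O π S u t h).real {y} *
      Real.log ((transcript O π S u t h).real {y} / (transcript (O' i) π S u t h).real {y}) ≤
        t * κ := by
  intro t
  induction t with
  | zero =>
    intro _
    simp only [transcript]
    refine (sum_nonpos fun i _ => sum_nonpos fun y _ => ?_).trans_eq (by simp)
    by_cases h : (Measure.dirac (Fin.elim0 : Fin 0 → Bits r)).real {y} = 0 <;> simp [h]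
  | succ t ih =>
    intro h
    have ih := ih (Nat.le_of_succ_le h)
    have := isProbabilityMeasure_transcript O π S u t (Nat.le_of_succ_le h)
    have hstep := sum_sum_mul_log_div_chain_le
      (k := fun (y : Fin t → Bits r) b => (messageLaw O π S u ⟨t, h⟩ y).real {b})
      (l := fun i (y : Fin t → Bits r) b => (messageLaw (O' i) π S u ⟨t, h⟩ y).real {b})
      (fun _ => measureReal_nonneg) (sum_real_singleton_eq_one _)
      (fun y => sum_real_singleton_eq_one (messageLaw O π S u ⟨t, h⟩ y))
      (fun i => transcript_real_eq_zero π S u (hac i) t (Nat.le_of_succ_le h))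
      (fun i => hac i ⟨t, h⟩) ih (hκ ⟨t, h⟩)
    rw [Nat.cast_succ, add_one_mul]
    refine le_of_eq_of_le (sum_congr rfl fun i _ => ?_) hstep
    rw [sum_snoc]
    refine sum_congr rfl fun y _ => sum_congr rfl fun b _ => ?_
    rw [transcript_succ_real, transcript_succ_real]

theorem measurable_transcript_singleton (O : Oracle X) [IsMarkovKernel O] (π : Algorithm X r T)
    (S : ChannelStrategy d r T) :
    ∀ t h y, Measurable fun u => transcript O π S u t h {y}
  | 0, _, y => by simp only [transcript]; exact measurable_const
  | t + 1, h, y => by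
    rw [← Fin.snoc_init_self y]
    simp only [transcript_succ_singleton]
    refine (measurable_transcript_singleton O π S t _ _).mul ?_
    exact (Kernel.measurable_coe _ (measurableSet_singleton _)).comp (π.measurable_query _ _)

/-- Assouad's lemma for the transcripts: if negating a coordinate of the parameter hardly changes
the law of the messages, then the average number of wrongly estimated signs is of order `d`. -/
theorem card_mul_le_sum_errors (O : (Fin d → Bool) → Oracle X)
    [∀ v, IsMarkovKernel (O v)] (π : Algorithm X r T) (S : ChannelStrategy d r T) (u : π.Seed)
    {κ : ℝ}
    (hac : ∀ v i t y b, (messageLaw (O (flipAt i v)) π S u t y).real {b} = 0 →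
      (messageLaw (O v) π S u t y).real {b} = 0)
    (hκ : ∀ v t y, ∑ i, ∑ b, (messageLaw (O v) π S u t y).real {b} *
      Real.log ((messageLaw (O v) π S u t y).real {b} /
        (messageLaw (O (flipAt i v)) π S u t y).real {b}) ≤ κ)
    (g : (Fin T → Bits r) → Fin d → Bool) :
    2 ^ d * ((d / 2 - T * κ) / 2) ≤
      ∑ v, ∑ y, (transcript (O v) π S u T le_rfl).real {y} *
        ∑ i, if g y i = v i then (0 : ℝ) else 1 := by
  set P : (Fin d → Bool) → (Fin T → Bits r) → ℝ :=
    fun v y => (transcript (O v) π S u T le_rfl).real {y} with hP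
  have hP1 : ∀ v, ∑ y, P v y = 1 := fun v => by
    have := isProbabilityMeasure_transcript (O v) π S u T le_rfl
    exact sum_real_singleton_eq_one _
  have hmin : ∀ v, d / 2 - T * κ ≤ ∑ i, ∑ y, min (P v y) (P (flipAt i v) y) := by
    intro v
    have h1 : ∑ i, ∑ y, P v y * Real.log (P v y / P (flipAt i v) y) ≤ T * κ :=
      sum_log_div_transcript_le (O' := fun i => O (flipAt i v)) π S u (hac v) (hκ v) T le_rfl
    calc d / 2 - T * κ ≤ ∑ i, ∑ y, (P v y / 2 - P v y * Real.log (P v y / P (flipAt i v) y) -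
          (P (flipAt i v) y - P v y)) := by
          simp only [sum_sub_distrib, ← sum_div, hP1]
          simp
          linarith
      _ ≤ _ := sum_le_sum fun i _ => sum_le_sum fun y _ =>
          half_sub_log_le_min measureReal_nonneg measureReal_nonneg
            (transcript_real_eq_zero π S u (hac v i) T le_rfl y)
  -- The estimate `g y i` disagrees with `v i` or with its negation, so one of the two indicators is
  -- 1.
  have hpair : ∀ v i y, min (P v y) (P (flipAt i v) y) ≤
      P v y * (if g y i = v i then (0 : ℝ) else 1) +
        P (flipAt i v) y * (if g y i = flipAt i v i then (0 : ℝ) else 1) := by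
    intro v i y
    have hv : flipAt i v i = !v i := by simp [flipAt]
    rw [hv]
    cases g y i <;> cases v i <;> simp
  -- Negating coordinate `i` is an involution of the cube, so it only reindexes the sum over `v`.
  have hinv : ∀ i, ∑ v, ∑ y, P (flipAt i v) y * (if g y i = flipAt i v i then (0 : ℝ) else 1) =
      ∑ v, ∑ y, P v y * (if g y i = v i then (0 : ℝ) else 1) := fun i =>
    Equiv.sum_comp (Function.Involutive.toPerm (flipAt i) (flipAt_flipAt i))
      fun v => ∑ y, P v y * (if g y i = v i then (0 : ℝ) else 1)
  have hsum : 2 ^ d * (d / 2 - T * κ) ≤ ∑ v, ∑ i, ∑ y, min (P v y) (P (flipAt i v) y) := by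
    calc _ = ∑ _v : Fin d → Bool, ((d : ℝ) / 2 - T * κ) := by
          rw [sum_const, nsmul_eq_mul]; simp
      _ ≤ _ := sum_le_sum fun v _ => hmin v
  have hle : ∑ v, ∑ i, ∑ y, min (P v y) (P (flipAt i v) y) ≤
      2 * ∑ v, ∑ y, P v y * ∑ i, if g y i = v i then (0 : ℝ) else 1 := by
    calc _ ≤ ∑ v, ∑ i, ∑ y, (P v y * (if g y i = v i then (0 : ℝ) else 1) +
          P (flipAt i v) y * (if g y i = flipAt i v i then (0 : ℝ) else 1)) :=
          sum_le_sum fun v _ => sum_le_sum fun i _ => sum_le_sum fun y _ => hpair v i y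
      _ = 2 * ∑ i, ∑ v, ∑ y, P v y * (if g y i = v i then (0 : ℝ) else 1) := by
          rw [sum_comm]
          simp only [sum_add_distrib, hinv, two_mul]
      _ = _ := by
          rw [sum_comm]
          congr 1
          refine sum_congr rfl fun v _ => ?_
          rw [sum_comm]
          exact sum_congr rfl fun y _ => (mul_sum _ _ _).symm
  linarith

end Transcript

/-! ### The hard oracles and quadratics -/

/-- The vector of signs `±1` encoded by a Boolean vector. -/
def signVec {d : ℕ} (v : Fin d → Bool) : Euc d := WithLp.toLp 2 fun i => boolSign (v i)

@[simp] theorem signVec_apply {d : ℕ} (v : Fin d → Bool) (i : Fin d) :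
    signVec v i = boolSign (v i) := rfl

theorem norm_signVec {d : ℕ} (v : Fin d → Bool) : ‖signVec v‖ = √d := by
  simp [EuclideanSpace.norm_eq]

/-- The oracle that answers `α • x - s • z` with a random sign vector `z` whose coordinates are
independent with means `ρ * boolSign (v i)`. -/
def signOracle {d : ℕ} (X : Set (Euc d)) (α s ρ : ℝ) (v : Fin d → Bool) : Oracle X where
  toFun x := ∑ z, ENNReal.ofReal (biasWeight ρ v z) •
    Measure.dirac (α • (x : Euc d) - s • signVec z)
  measurable' := by
    refine Measure.measurable_of_measurable_coe _ fun A hA => ?_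
    simp only [Measure.finsetSum_apply, Measure.smul_apply, smul_eq_mul]
    refine Finset.measurable_sum _ fun z _ => Measurable.const_mul ?_ _
    exact (Measure.measurable_coe hA).comp (Measure.measurable_dirac.comp (by fun_prop))

section

variable {d : ℕ} {X : Set (Euc d)} {α s ρ : ℝ}

theorem signOracle_apply (v : Fin d → Bool) (x : X) :
    signOracle X α s ρ v x = ∑ z, ENNReal.ofReal (biasWeight ρ v z) •
      Measure.dirac (α • (x : Euc d) - s • signVec z) := rfl

theorem isMarkovKernel_signOracle (hρ : 0 < ρ) (hρ' : ρ ≤ 1 / 2) (v : Fin d → Bool) :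
    IsMarkovKernel (signOracle X α s ρ v) := by
  refine ⟨fun x => ⟨?_⟩⟩
  rw [signOracle_apply]
  simp only [Measure.finsetSum_apply, Measure.smul_apply, measure_univ, smul_eq_mul, mul_one]
  rw [← ENNReal.ofReal_sum_of_nonneg fun z _ => biasWeight_nonneg hρ hρ' v z, sum_biasWeight,
    ENNReal.ofReal_one]

theorem integral_signOracle (hρ : 0 < ρ) (hρ' : ρ ≤ 1 / 2) (v : Fin d → Bool) (x : X) :
    ∫ g, g ∂(signOracle X α s ρ v x) = α • (x : Euc d) - (s * ρ) • signVec v := by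
  rw [signOracle_apply, integral_finsetSum_measure]
  · simp only [integral_smul_measure, integral_dirac,
      ENNReal.toReal_ofReal (biasWeight_nonneg hρ hρ' v _)]
    ext i
    simp only [WithLp.ofLp_sum, Finset.sum_apply, PiLp.smul_apply, PiLp.sub_apply, smul_eq_mul,
      signVec_apply, mul_sub, sum_sub_distrib, ← sum_mul, sum_biasWeight, one_mul]
    congr 1
    calc _ = s * ∑ z, biasWeight ρ v z * boolSign (z i) := by
          rw [mul_sum]; exact sum_congr rfl fun z _ => by ring
      _ = _ := by rw [sum_biasWeight_mul_sign]; ring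
  · intro z _
    exact (integrable_dirac (by simp)).smul_measure ENNReal.ofReal_ne_top

theorem ae_signOracle {p : Euc d → Prop} (v : Fin d → Bool) (x : X)
    (h : ∀ z, p (α • (x : Euc d) - s • signVec z)) :
    ∀ᵐ g ∂(signOracle X α s ρ v x), p g := by
  rw [signOracle_apply, ae_iff, Measure.finsetSum_apply]
  refine sum_eq_zero fun z _ => ?_
  have : (Measure.dirac (α • (x : Euc d) - s • signVec z)) {g | ¬p g} = 0 := by
    rw [← ae_iff, ae_dirac_eq]
    exact h z
  simp [this]

/-- Given seed and history the query is fixed, so the shift `α x` belongs to an effective channel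
acting on `z` that does not depend on `v`. -/
theorem messageLaw_signOracle_real (hρ : 0 < ρ) (hρ' : ρ ≤ 1 / 2) (v : Fin d → Bool) {r T : ℕ}
    (π : Algorithm X r T) (S : ChannelStrategy d r T) (u : π.Seed) (t : Fin T)
    (y : Fin t → Bits r) (b : Bits r) :
    (messageLaw (signOracle X α s ρ v) π S u t y).real {b} =
      ∑ z, biasWeight ρ v z *
        ((S t y).1 (α • (π.query t u y : Euc d) - s • signVec z)).real {b} := by
  have := (S t y).2
  rw [messageLaw, measureReal_def, Kernel.comp_apply' _ _ _ (measurableSet_singleton _),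
    signOracle_apply, lintegral_finsetSum_measure, ENNReal.toReal_sum]
  · simp [lintegral_smul_measure, ENNReal.toReal_mul, measureReal_def,
      ENNReal.toReal_ofReal (biasWeight_nonneg hρ hρ' v _)]
  · intro z _
    simp [lintegral_smul_measure, ENNReal.mul_eq_top]

theorem messageLaw_signOracle_eq_zero (hρ : 0 < ρ) (hρ' : ρ ≤ 1 / 2) (v : Fin d → Bool)
    (i : Fin d) {r T : ℕ} (π : Algorithm X r T) (S : ChannelStrategy d r T) (u : π.Seed)
    (t : Fin T) (y : Fin t → Bits r) (b : Bits r)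
    (h : (messageLaw (signOracle X α s ρ (flipAt i v)) π S u t y).real {b} = 0) :
    (messageLaw (signOracle X α s ρ v) π S u t y).real {b} = 0 := by
  rw [messageLaw_signOracle_real hρ hρ'] at h ⊢
  rw [sum_eq_zero_iff_of_nonneg fun z _ =>
    mul_nonneg (biasWeight_nonneg hρ hρ' _ _) measureReal_nonneg] at h
  refine sum_eq_zero fun z hz => ?_
  have hz := h z hz
  rw [biasWeight_flipAt hρ hρ'] at hz
  have hb := (biasScore_bounds hρ hρ' v z i).2.1
  have hne : 1 - biasScore ρ v i z ≠ 0 := by linarith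
  simpa [hne] using hz

theorem sum_log_div_messageLaw_signOracle_le (hρ : 0 < ρ) (hρ' : ρ ≤ 1 / 2)
    (v : Fin d → Bool) {r T : ℕ} (π : Algorithm X r T) (S : ChannelStrategy d r T) (u : π.Seed)
    (t : Fin T) (y : Fin t → Bits r) :
    ∑ i, ∑ b, (messageLaw (signOracle X α s ρ v) π S u t y).real {b} *
      Real.log ((messageLaw (signOracle X α s ρ v) π S u t y).real {b} /
        (messageLaw (signOracle X α s ρ (flipAt i v)) π S u t y).real {b}) ≤
      96 * ρ ^ 2 * (min d r : ℕ) := by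
  have := (S t y).2
  simp only [messageLaw_signOracle_real hρ hρ']
  exact sum_log_div_channel_le hρ hρ' v
    (fun b z => ((S t y).1 (α • (π.query t u y : Euc d) - s • signVec z)).real {b})
    (fun _ _ => measureReal_nonneg) (fun _ => sum_real_singleton_eq_one _)

/-- The quadratic with Hessian `α` and minimizer `a`. -/
def quadratic (α : ℝ) (a x : Euc d) : ℝ := α / 2 * ‖x - a‖ ^ 2

theorem quadratic_signOracle_mem_strongConvexClass {B : ℝ} (hα : 0 < α) (hρ : 0 < ρ)
    (hρ' : ρ ≤ 1 / 2) (hX : Convex ℝ X)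
    (hB : ∀ x ∈ X, ∀ z : Fin d → Bool, ‖α • x - s • signVec z‖ ≤ B) (v : Fin d → Bool) :
    (quadratic α ((s * ρ / α) • signVec v), signOracle X α s ρ v) ∈ strongConvexClass X α B := by
  -- Removing `α/2 * ‖x‖ ^ 2` leaves an affine function, so strong convexity with modulus `α` is
  -- exact.
  have haff : ∀ a x : Euc d, quadratic α a x - α / 2 * ‖x‖ ^ 2 =
      (-α • innerSL ℝ a).toLinearMap x + α / 2 * ‖a‖ ^ 2 := by
    intro a x
    simp only [quadratic, norm_sub_sq_real]
    simp [real_inner_comm x a]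
    ring
  have hlin : ∀ a : Euc d, ConvexOn ℝ X fun x => quadratic α a x - α / 2 * ‖x‖ ^ 2 := by
    intro a
    simp only [haff]
    exact ((LinearMap.convexOn _ hX).add (convexOn_const _ hX))
  have hsq : ConvexOn ℝ X fun x : Euc d => α / 2 * ‖x‖ ^ 2 := by
    have := ((convexOn_norm hX).pow (fun x _ => norm_nonneg x) 2).smul (half_pos hα).le
    simpa using this
  refine ⟨?_, hlin _, isMarkovKernel_signOracle hρ hρ' v, fun x y _ => ?_, fun x => ?_⟩
  · have := (hlin ((s * ρ / α) • signVec v)).add hsq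
    simpa [Pi.add_def] using this
  · change _ + inner ℝ (∫ g, g ∂(signOracle X α s ρ v x)) _ ≤ _
    rw [integral_signOracle hρ hρ']
    have h1 : α • (x : Euc d) - (s * ρ) • signVec v =
        α • ((x : Euc d) - (s * ρ / α) • signVec v) := by
      rw [smul_sub, smul_smul, mul_div_cancel₀ _ hα.ne']
    rw [h1, real_inner_smul_left]
    simp only [quadratic]
    have h2 : y - (s * ρ / α) • signVec v =
        ((x : Euc d) - (s * ρ / α) • signVec v) + (y - x) := by abel
    rw [h2, norm_add_sq_real]
    nlinarith [mul_nonneg hα.le (sq_nonneg ‖y - (x : Euc d)‖)]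
  · exact ae_signOracle v x fun z => pow_le_pow_left₀ (norm_nonneg _) (hB x x.2 z) 2

/-- A coordinate on the wrong side of 0 is at distance at least `γ` from its target `± γ`. -/
theorem errors_le_quadratic (hα : 0 < α) {γ : ℝ} (hγ : 0 ≤ γ) (v : Fin d → Bool) (x : Euc d) :
    α / 2 * γ ^ 2 * ∑ i, (if decide (0 ≤ x i) = v i then (0 : ℝ) else 1) ≤
      quadratic α (γ • signVec v) x := by
  rw [quadratic, EuclideanSpace.real_norm_sq_eq, mul_assoc, mul_sum]
  refine mul_le_mul_of_nonneg_left (sum_le_sum fun i _ => ?_) (half_pos hα).le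
  simp only [PiLp.sub_apply, PiLp.smul_apply, signVec_apply, smul_eq_mul]
  by_cases hx : 0 ≤ x i <;> cases v i <;> simp [hx] <;> nlinarith

/-- The worst case dominates the average over `v`. The Assouad bound is uniform in the seed, so
private randomness does not help. -/
theorem minmaxError_closedBall_ge {r T : ℕ} {R B : ℝ} (hd : 1 ≤ d) (hα : 0 < α) (hB : 0 < B)
    (hρ : 0 < ρ) (hρ' : ρ ≤ 1 / 2) (hR : α * R ≤ B / 2) (hγR : B * ρ / (2 * α) ≤ R)
    (hT : T * (96 * ρ ^ 2 * (min d r : ℕ)) ≤ (d : ℝ) / 4) :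
    ENNReal.ofReal (B ^ 2 * ρ ^ 2 / (64 * α)) ≤
      minmaxError (Metric.closedBall (0 : Euc d) R) α B r T := by
  have hd0 : (0 : ℝ) < d := by exact_mod_cast hd
  have hsd : 0 < √(d : ℝ) := Real.sqrt_pos.2 hd0
  set X := Metric.closedBall (0 : Euc d) R with hX
  -- Since `‖z‖ = √d`, the noise uses half of the norm budget `B`; `hR` leaves the other half to `α
  -- x`.
  set s : ℝ := B / (2 * √d) with hs
  set γ : ℝ := s * ρ / α with hγ
  have hs0 : 0 < s := by positivity
  have hγ0 : 0 < γ := by positivity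
  set O : (Fin d → Bool) → Oracle X := signOracle X α s ρ with hO
  set f : (Fin d → Bool) → Euc d → ℝ := fun v => quadratic α (γ • signVec v) with hf
  have hmarkov : ∀ v, IsMarkovKernel (O v) := isMarkovKernel_signOracle hρ hρ'
  have hmem : ∀ v, (f v, O v) ∈ strongConvexClass X α B := by
    refine quadratic_signOracle_mem_strongConvexClass hα hρ hρ' (convex_closedBall _ _) ?_
    intro x hx z
    refine (norm_sub_le _ _).trans ?_
    rw [norm_smul, norm_smul, norm_signVec, Real.norm_of_nonneg hα.le, Real.norm_of_nonneg hs0.le]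
    have h1 : α * ‖x‖ ≤ α * R := mul_le_mul_of_nonneg_left (mem_closedBall_zero_iff.1 hx) hα.le
    have h2 : s * √d = B / 2 := by rw [hs]; field_simp
    linarith
  -- By `hγR` the minimizer `γ v` lies in the ball.
  have hinf : ∀ v, ⨅ x : X, f v x ≤ 0 := by
    intro v
    have hx : γ • signVec v ∈ X := by
      rw [hX, mem_closedBall_zero_iff, norm_smul, norm_signVec, Real.norm_of_nonneg hγ0.le]
      refine le_of_eq_of_le ?_ hγR
      rw [hγ, hs]; field_simp
    refine (ciInf_le ⟨0, ?_⟩ (⟨_, hx⟩ : X)).trans_eq (by simp [hf, quadratic])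
    rintro _ ⟨x, rfl⟩
    simp only [hf, quadratic]
    positivity
  refine le_iInf₂ fun π S => ?_
  have hpt : ∀ u, ENNReal.ofReal (2 ^ d * (B ^ 2 * ρ ^ 2 / (64 * α))) ≤
      ∑ v, ∫⁻ y, ENNReal.ofReal (f v (π.output u y) - ⨅ x : X, f v x)
        ∂(transcript (O v) π S u T le_rfl) := by
    intro u
    have hA := card_mul_le_sum_errors O π S u
      (fun v i => messageLaw_signOracle_eq_zero hρ hρ' v i π S u)
      (fun v => sum_log_div_messageLaw_signOracle_le hρ hρ' v π S u)
      fun y i => decide (0 ≤ (π.output u y : Euc d) i)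
    have hle : 2 ^ d * (B ^ 2 * ρ ^ 2 / (64 * α)) ≤
        ∑ v, ∑ y, (f v (π.output u y) - ⨅ x : X, f v x) *
          (transcript (O v) π S u T le_rfl).real {y} := by
      have h1 : α / 2 * γ ^ 2 * (2 ^ d * ((d : ℝ) / 8)) = 2 ^ d * (B ^ 2 * ρ ^ 2 / (64 * α)) := by
        rw [hγ, hs]
        field_simp
        rw [Real.sq_sqrt hd0.le]
        ring
      -- By `hT` at least `(d/2 - d/4) / 2 = d/8` signs are wrong on average.
      have h2 : (2 : ℝ) ^ d * ((d : ℝ) / 8) ≤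
          2 ^ d * (((d : ℝ) / 2 - T * (96 * ρ ^ 2 * (min d r : ℕ))) / 2) :=
        mul_le_mul_of_nonneg_left (by linarith) (by positivity)
      rw [← h1]
      refine (mul_le_mul_of_nonneg_left (h2.trans hA) (by positivity)).trans ?_
      rw [mul_sum]
      refine sum_le_sum fun v _ => ?_
      rw [mul_sum]
      refine sum_le_sum fun y _ => ?_
      rw [mul_left_comm, mul_comm]
      refine mul_le_mul_of_nonneg_right ?_ measureReal_nonneg
      linarith [errors_le_quadratic hα hγ0.le v (π.output u y : Euc d), hinf v]
    refine (ENNReal.ofReal_le_ofReal hle).trans ?_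
    have hnn : ∀ v y, 0 ≤ f v (π.output u y) - ⨅ x : X, f v x := by
      intro v y
      have : 0 ≤ f v (π.output u y) := by simp only [hf, quadratic]; positivity
      linarith [hinf v]
    rw [ENNReal.ofReal_sum_of_nonneg fun v _ =>
      sum_nonneg fun y _ => mul_nonneg (hnn v y) measureReal_nonneg]
    refine sum_le_sum fun v _ => ?_
    have := isProbabilityMeasure_transcript (O v) π S u T le_rfl
    rw [lintegral_fintype, ENNReal.ofReal_sum_of_nonneg fun y _ =>
      mul_nonneg (hnn v y) measureReal_nonneg]
    refine sum_le_sum fun y _ => ?_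
    rw [ENNReal.ofReal_mul (hnn v y), ofReal_measureReal]
  have hmeas : ∀ v, Measurable fun u => ∫⁻ y, ENNReal.ofReal
      (f v (π.output u y) - ⨅ x : X, f v x) ∂(transcript (O v) π S u T le_rfl) := by
    intro v
    simp only [lintegral_fintype]
    refine Finset.measurable_sum _ fun y _ =>
      Measurable.mul ?_ (measurable_transcript_singleton _ _ _ _ _ _)
    have hfm : Measurable (f v) := by
      have : Continuous (f v) := by simp only [hf]; unfold quadratic; fun_prop
      exact this.measurable
    exact ((hfm.comp (measurable_subtype_coe.comp (π.measurable_output y))).sub_const _).ennreal_ofReal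
  have hsum : ENNReal.ofReal (2 ^ d * (B ^ 2 * ρ ^ 2 / (64 * α))) ≤
      ∑ v, optError (f v) (O v) π S := by
    simp only [optError]
    rw [← lintegral_finsetSum _ fun v _ => hmeas v]
    refine le_trans (by simp) (lintegral_mono hpt)
  have hsup : ∑ v, optError (f v) (O v) π S ≤
      2 ^ d * ⨆ p ∈ strongConvexClass X α B, optError p.1 p.2 π S := by
    refine (sum_le_sum fun v _ => le_iSup₂_of_le (f := fun p (_ : p ∈ strongConvexClass X α B) =>
      optError p.1 p.2 π S) (f v, O v) (hmem v) le_rfl).trans_eq ?_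
    simp
  have := hsum.trans hsup
  rw [ENNReal.ofReal_mul (by positivity), ENNReal.ofReal_pow zero_le_two] at this
  rw [ENNReal.ofReal_ofNat] at this
  exact (ENNReal.mul_le_mul_iff_right (by simp) (by simp)).1 this

end

end Construction

end Auxiliary

/-! ### Choice of radius and bias -/

theorem theoremt :
    ∃ c₀ c₁ : ℝ, 0 < c₀ ∧ 0 < c₁ ∧
      ∀ (d r T : ℕ) (D B α : ℝ), 1 ≤ d → 1 ≤ r → 0 < D → 0 < B → 0 < α →
        D / 8 ≤ B / α →
        c₀ * (B ^ 2 / (α ^ 2 * D ^ 2)) * ((d : ℝ) / (min d r : ℕ)) ≤ (T : ℝ) →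
        ENNReal.ofReal (c₁ * B ^ 2 / (α * T) * ((d : ℝ) / (min d r : ℕ))) ≤
          ⨆ X ∈ domainFamily d D, minmaxError X α B r T := by
  -- `24576 = 64 * 384`: the 64 comes from the bound on the ball, the 384 from the choice of `ρ ^
  -- 2`.
  refine ⟨1, 1 / 24576, one_pos, by norm_num, ?_⟩
  intro d r T D B α hd hr hD hB hα hBα hT
  have hd0 : (0 : ℝ) < d := by exact_mod_cast hd
  have hm0 : (0 : ℝ) < (min d r : ℕ) := by exact_mod_cast lt_min hd hr
  set m : ℝ := ((min d r : ℕ) : ℝ) with hm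
  have hT0 : (0 : ℝ) < T := lt_of_lt_of_le (by positivity) hT
  have hDB : α * D ≤ 8 * B := by
    rw [div_le_div_iff₀ (by norm_num) hα] at hBα
    linarith
  have hq0 : 0 < (d : ℝ) / (384 * m * T) := by positivity
  -- This gives `T * (96 * ρ ^ 2 * m) = d / 4`, the largest bias that Assouad's bound allows here.
  set ρ : ℝ := √((d : ℝ) / (384 * m * T)) with hρdef
  have hρ : 0 < ρ := Real.sqrt_pos.2 hq0
  have hρ2 : ρ ^ 2 = (d : ℝ) / (384 * m * T) := Real.sq_sqrt hq0.le
  have hkey : B ^ 2 * ρ ^ 2 ≤ α ^ 2 * D ^ 2 / 384 := by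
    have h1 : B ^ 2 * (d / m) ≤ T * (α ^ 2 * D ^ 2) := by
      rw [one_mul, div_mul_eq_mul_div, div_le_iff₀ (by positivity)] at hT
      exact hT
    have h2 : B ^ 2 * ρ ^ 2 = B ^ 2 * (d / m) / (384 * T) := by rw [hρ2]; field_simp
    rw [h2, div_le_div_iff₀ (by positivity) (by norm_num)]
    linarith
  have hρ' : ρ ≤ 1 / 2 := by
    have h1 : α ^ 2 * D ^ 2 ≤ 64 * B ^ 2 := by
      have := pow_le_pow_left₀ (by positivity) hDB 2
      linarith [mul_pow α D 2, mul_pow 8 B 2]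
    have h2 : B ^ 2 * ρ ^ 2 ≤ B ^ 2 * (1 / 2) ^ 2 := by linarith [sq_nonneg B]
    exact le_of_sq_le_sq (le_of_mul_le_mul_left h2 (by positivity)) (by norm_num)
  have hγ : B * ρ / (2 * α) ≤ D / 16 := by
    have h1 : B * ρ ≤ α * D / 8 := by
      refine le_of_sq_le_sq ?_ (by positivity)
      have : 0 ≤ α ^ 2 * D ^ 2 := by positivity
      calc _ = B ^ 2 * ρ ^ 2 := mul_pow _ _ _
        _ ≤ α ^ 2 * D ^ 2 / 64 := by linarith
        _ = _ := by ring
    rw [div_le_div_iff₀ (by positivity) (by norm_num)]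
    linarith
  -- For `R = D / 16` the requirement `α * R ≤ B / 2` is exactly `D / 8 ≤ B / α`; the lower bound on
  -- `T` keeps the minimizers within this radius.
  have hmain := minmaxError_closedBall_ge (d := d) (r := r) (T := T) (R := D / 16) hd hα hB hρ hρ'
    (by linarith) hγ (by rw [← hm, hρ2]; apply le_of_eq; field_simp; norm_num)
  refine le_trans (le_of_eq ?_) (hmain.trans (le_iSup₂_of_le _ ?_ le_rfl))
  · rw [hρ2]
    congr 1
    field_simp
    norm_num
  · refine ⟨⟨0, by simp; positivity⟩, fun x hx y hy => ?_⟩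
    have h1 := mem_closedBall_zero_iff.1 hx
    have h2 := mem_closedBall_zero_iff.1 hy
    linarith [norm_sub_le x y]
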